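/- Let $a\in\mathbb C$ with $-1<\Re(a)<0$ and let $\xi\in\mathbb R$. Then the integrals below converge absolutely and $$\int_{-\infty}^{\infty}\Gamma(a+it)\,\Gamma(a-it)\,e^{-i\xi t}\,dt =-\frac{\sqrt{\pi}\,\Gamma(a+1)\,\Gamma\left(a+\tfrac32\right)}{a} \left\{\cosh(a\xi)\int_0^{\infty}\frac{e^{as}}{\cosh^{2a+2}\left(\frac s2\right)}\,ds +\int_0^{\xi}\frac{\sinh\left(a(\xi-s)\right)}{\cosh^{2a+2}\left(\frac s2\right)}\,ds\right\},$$ where $\cosh^{2a+2}(s/2)=\exp\left((2a+2)\log\cosh(s/2)\right)$ with the real logarithm, and $\int_0^{\xi}=-\int_{\xi}^0$ if $\xi<0$. -/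

import Mathlib

open MeasureTheory

/-!
Put `b = a + 1`. The substitution `x = (1 + e⁻ˢ)⁻¹` turns the Beta integral into
`Γ(b + it) Γ(b - it) = C ∫ e^{-its} sech(s/2)^{2b} ds`, while the functional equation gives
`Γ(a + it) Γ(a - it) = Γ(b + it) Γ(b - it) / (a² + t²)`, and `-2a / (a² + t²)` is the Fourier
transform of `e^{a|x|}` because `Re a < 0`. The integrand is thus a product of two Fourier
transforms, and Fourier inversion identifies its transform with the convolution
`∫ e^{a|ξ - s|} sech(s/2)^{2a+2} ds`. Splitting at `s = ξ` and moving the endpoint to `0`, with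
evenness of `sech`, leaves the hyperbolic cosine and sine terms.
-/

section

open Complex Set FourierTransform Convolution

open scoped Real

/-! ### Products of Fourier transforms -/

section FourierProduct

variable {V : Type*} [NormedAddCommGroup V] [InnerProductSpace ℝ V] [FiniteDimensional ℝ V]
  [MeasurableSpace V] [BorelSpace V]

lemma integrable_fourier_mul_fourier {f g : V → ℂ} (hf : Integrable (𝓕 f)) (hg : Integrable g) :
    Integrable (fun w => 𝓕 f w * 𝓕 g w) := by
  have hcont : Continuous (𝓕 g) :=
    VectorFourier.fourierIntegral_continuous Real.continuous_fourierChar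
      (L := innerₗ V) continuous_inner hg
  exact hf.mul_bdd hcont.aestronglyMeasurable <| .of_forall
    fun w =>
    VectorFourier.norm_fourierIntegral_le_integral_norm Real.fourierChar volume (innerₗ V) g w

lemma fourierInv_fourier_mul_fourier {f g : V → ℂ} (hfc : Continuous f) (hf : Integrable f)
    (hf' : Integrable (𝓕 f)) (hg : Integrable g) :
    𝓕⁻ (fun w => 𝓕 f w * 𝓕 g w) = f ⋆[ContinuousLinearMap.mul ℂ ℂ] g := by
  have hbdd : BddAbove (range fun x => ‖f x‖) := by
    refine ⟨∫ w, ‖𝓕 f w‖, ?_⟩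
    rintro _ ⟨x, rfl⟩
    calc ‖f x‖ = ‖𝓕⁻ (𝓕 f) x‖ := by rw [hfc.fourierInv_fourier_eq hf hf']
      _ ≤ ∫ w, ‖𝓕 f w‖ := VectorFourier.norm_fourierIntegral_le_integral_norm
          Real.fourierChar volume (-innerₗ V) (𝓕 f) x
  have hfourier : 𝓕 (f ⋆[ContinuousLinearMap.mul ℂ ℂ] g) = fun w => 𝓕 f w * 𝓕 g w :=
    funext (Real.fourier_mul_convolution_eq hf hg)
  rw [← hfourier]
  refine (hbdd.continuous_convolution_left_of_integrable _ hfc hg).fourierInv_fourier_eq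
    (hf.integrable_convolution _ hg) ?_
  rw [hfourier]
  exact integrable_fourier_mul_fourier hf' hg

lemma fourier_fourier_mul_fourier_of_even {f g : V → ℂ} (hfc : Continuous f) (hf : Integrable f)
    (hf' : Integrable (𝓕 f)) (hg : Integrable g) (hfe : f.Even) (hge : g.Even) :
    𝓕 (fun w => 𝓕 f w * 𝓕 g w) = f ⋆[ContinuousLinearMap.mul ℂ ℂ] g := by
  ext ξ
  rw [← neg_neg ξ, ← Real.fourierInv_eq_fourier_neg, fourierInv_fourier_mul_fourier hfc hf hf' hg,
    convolution_neg_of_neg_eq _ (.of_forall hfe) (.of_forall hge), neg_neg]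

end FourierProduct

/-! ### The unnormalised Fourier integral on the line -/

lemma integrable_mul_exp_neg_I_mul {h : ℝ → ℂ} (hh : Integrable h) (ξ : ℝ) :
    Integrable (fun t : ℝ => h t * exp (-I * ξ * t)) :=
  hh.mul_bdd (c := 1) (Continuous.aestronglyMeasurable (by fun_prop))
    (.of_forall fun t => by simp [norm_exp])

lemma fourier_eq_integral_mul_exp (h : ℝ → ℂ) (w : ℝ) :
    𝓕 h w = ∫ x : ℝ, h x * exp (-I * ((2 * π * w : ℝ) : ℂ) * x) := by
  rw [Real.fourier_real_eq_integral_exp_smul]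
  congr with x
  rw [smul_eq_mul, mul_comm]
  push_cast
  ring_nf

lemma integral_mul_exp_neg_I_mul (h : ℝ → ℂ) (ξ : ℝ) :
    ∫ t : ℝ, h t * exp (-I * ξ * t) = 2 * π * 𝓕 (fun w : ℝ => h (2 * π * w)) ξ := by
  have hscale := Measure.integral_comp_mul_left (fun t : ℝ => h t * exp (-I * ξ * t)) (2 * π)
  have hfourier : 𝓕 (fun w : ℝ => h (2 * π * w)) ξ =
      ∫ w : ℝ, h (2 * π * w) * exp (-I * ξ * ((2 * π * w : ℝ) : ℂ)) := by
    rw [fourier_eq_integral_mul_exp]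
    congr with w
    push_cast
    ring_nf
  rw [hfourier, hscale, abs_of_pos (by positivity), real_smul]
  push_cast
  field_simp

/-! ### The two-sided exponential -/

/-- The two-sided exponential `x ↦ e^{a|x|}`, whose Fourier transform is the factor
`-2a / (a² + t²)` produced by the functional equation of `Γ`. -/
noncomputable def twoSidedExp (a : ℂ) (x : ℝ) : ℂ := exp (a * |x|)

lemma twoSidedExp_of_nonneg (a : ℂ) {x : ℝ} (hx : 0 ≤ x) : twoSidedExp a x = exp (a * x) := by
  rw [twoSidedExp, abs_of_nonneg hx]

lemma even_twoSidedExp (a : ℂ) : (twoSidedExp a).Even := fun x => by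
  rw [twoSidedExp, abs_neg, twoSidedExp]

lemma twoSidedExp_of_nonpos (a : ℂ) {x : ℝ} (hx : x ≤ 0) : twoSidedExp a x = exp (-(a * x)) := by
  rw [← even_twoSidedExp, twoSidedExp_of_nonneg a (neg_nonneg.2 hx), ofReal_neg, mul_neg]

lemma continuous_twoSidedExp (a : ℂ) : Continuous (twoSidedExp a) := by
  unfold twoSidedExp; fun_prop

lemma integrable_twoSidedExp {a : ℂ} (ha : a.re < 0) : Integrable (twoSidedExp a) := by
  have hright : IntegrableOn (twoSidedExp a) (Ioi 0) :=
    (integrableOn_exp_mul_complex_Ioi ha 0).congr_fun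
      (fun x hx => (twoSidedExp_of_nonneg a (mem_Ioi.1 hx).le).symm) measurableSet_Ioi
  have hleft : IntegrableOn (twoSidedExp a) (Iic 0) :=
    (integrableOn_exp_mul_complex_Iic (a := -a) (by simpa) 0).congr_fun
      (fun x hx => by simp only [twoSidedExp_of_nonpos a (mem_Iic.1 hx), neg_mul]) measurableSet_Iic
  rw [← integrableOn_univ, ← Iic_union_Ioi (a := (0 : ℝ))]
  exact hleft.union hright

lemma add_I_mul_ne_zero {a : ℂ} (ha : a.re ≠ 0) (t : ℝ) : a + I * t ≠ 0 :=
  fun h => ha (by simpa using congrArg re h)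

lemma sub_I_mul_ne_zero {a : ℂ} (ha : a.re ≠ 0) (t : ℝ) : a - I * t ≠ 0 := by
  simpa [sub_eq_add_neg] using add_I_mul_ne_zero ha (-t)

lemma add_I_mul_mul_sub_I_mul (a t : ℂ) : (a + I * t) * (a - I * t) = a ^ 2 + t ^ 2 := by
  linear_combination -t ^ 2 * I_sq

lemma sq_re_le_norm_sq_add_sq (a : ℂ) (t : ℝ) : a.re ^ 2 ≤ ‖a ^ 2 + (t : ℂ) ^ 2‖ := by
  have hadd : |a.re| ≤ ‖a + I * t‖ := by simpa using abs_re_le_norm (a + I * t)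
  have hsub : |a.re| ≤ ‖a - I * t‖ := by simpa using abs_re_le_norm (a - I * t)
  rw [← add_I_mul_mul_sub_I_mul, norm_mul, ← sq_abs, sq]
  gcongr

lemma integrable_inv_sq_add_sq {a : ℂ} (ha : a.re ≠ 0) :
    Integrable (fun t : ℝ => (a ^ 2 + (t : ℂ) ^ 2)⁻¹) := by
  have hne : ∀ t : ℝ, a ^ 2 + (t : ℂ) ^ 2 ≠ 0 := fun t =>
    norm_pos_iff.1 ((by positivity : 0 < a.re ^ 2).trans_le (sq_re_le_norm_sq_add_sq a t))
  have hbase : Integrable (fun t : ℝ => (((1 + t ^ 2)⁻¹ : ℝ) : ℂ)) :=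
    integrable_inv_one_add_sq.ofReal
  have hbound : ∀ t : ℝ, ‖1 + (1 - a ^ 2) * (a ^ 2 + (t : ℂ) ^ 2)⁻¹‖ ≤
      1 + ‖1 - a ^ 2‖ * (a.re ^ 2)⁻¹ := fun t => by
    refine (norm_add_le _ _).trans ?_
    rw [norm_one, norm_mul, norm_inv]
    gcongr
    exact sq_re_le_norm_sq_add_sq a t
  have hcont : Continuous (fun t : ℝ => 1 + (1 - a ^ 2) * (a ^ 2 + (t : ℂ) ^ 2)⁻¹) :=
    continuous_const.add (continuous_const.mul (Continuous.inv₀ (by fun_prop) hne))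
  refine (hbase.mul_bdd hcont.aestronglyMeasurable (.of_forall hbound)).congr
    (.of_forall fun t => ?_)
  have hne' : (1 : ℂ) + (t : ℂ) ^ 2 ≠ 0 := by
    exact_mod_cast (by positivity : (1 : ℝ) + t ^ 2 ≠ 0)
  have := hne t
  push_cast
  field_simp
  ring

lemma fourier_twoSidedExp {a : ℂ} (ha : a.re < 0) (w : ℝ) :
    𝓕 (twoSidedExp a) w = -2 * a * (a ^ 2 + ((2 * π * w : ℝ) : ℂ) ^ 2)⁻¹ := by
  set t : ℝ := 2 * π * w with ht
  have hint := integrable_mul_exp_neg_I_mul (integrable_twoSidedExp ha) t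
  have hright : ∫ x in Ioi (0 : ℝ), twoSidedExp a x * exp (-I * t * x) = -(a - I * t)⁻¹ := by
    have hre : (a - I * t).re < 0 := by simpa
    calc _ = ∫ x in Ioi (0 : ℝ), exp ((a - I * t) * x) :=
          setIntegral_congr_fun measurableSet_Ioi fun x hx => by
            simp only [twoSidedExp_of_nonneg a (mem_Ioi.1 hx).le, ← exp_add]
            ring_nf
      _ = _ := by rw [integral_exp_mul_complex_Ioi hre]; simp [neg_div]
  have hleft : ∫ x in Iic (0 : ℝ), twoSidedExp a x * exp (-I * t * x) = -(a + I * t)⁻¹ := by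
    have hre : 0 < (-(a + I * t)).re := by simpa
    calc _ = ∫ x in Iic (0 : ℝ), exp (-(a + I * t) * x) :=
          setIntegral_congr_fun measurableSet_Iic fun x hx => by
            simp only [twoSidedExp_of_nonpos a (mem_Iic.1 hx), ← exp_add]
            ring_nf
      _ = _ := by rw [integral_exp_mul_complex_Iic hre]; simp [← inv_neg, add_comm]
  rw [fourier_eq_integral_mul_exp, ← ht,
    ← intervalIntegral.integral_Iic_add_Ioi hint.integrableOn hint.integrableOn, hleft, hright,
    ← add_I_mul_mul_sub_I_mul]
  have := add_I_mul_ne_zero ha.ne t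
  have := sub_I_mul_ne_zero ha.ne t
  field_simp
  ring

lemma integrable_fourier_twoSidedExp {a : ℂ} (ha : a.re < 0) :
    Integrable (𝓕 (twoSidedExp a)) := by
  rw [funext (fourier_twoSidedExp ha)]
  exact ((integrable_inv_sq_add_sq ha.ne).const_mul _).comp_mul_left' Real.two_pi_pos.ne'

/-! ### Convolution of the two-sided exponential with an even function -/

section Convolution

variable {a : ℂ} {W : ℝ → ℂ}

lemma integrableOn_Ioi_exp_mul (ha : a.re ≤ 0) (hW : Integrable W) (c : ℝ) :
    IntegrableOn (fun s : ℝ => exp (a * s) * W s) (Ioi c) := by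
  refine hW.integrableOn.bdd_mul (c := Real.exp (a.re * c))
    (Continuous.aestronglyMeasurable (by fun_prop))
    (ae_restrict_of_forall_mem measurableSet_Ioi fun s hs => ?_)
  rw [norm_exp, Real.exp_le_exp]
  simpa using mul_le_mul_of_nonpos_left (mem_Ioi.1 hs).le ha

lemma integrableOn_Iic_exp_neg_mul (ha : a.re ≤ 0) (hW : Integrable W) (c : ℝ) :
    IntegrableOn (fun s : ℝ => exp (-(a * s)) * W s) (Iic c) := by
  have h := (integrableOn_Ioi_exp_mul ha hW.comp_neg (-c)).comp_neg_Iio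
  rw [integrableOn_Iic_iff_integrableOn_Iio]
  simpa using h

lemma setIntegral_Iic_exp_neg_mul_of_even (hWe : W.Even) :
    ∫ s in Iic (0 : ℝ), exp (-(a * s)) * W s = ∫ s in Ioi (0 : ℝ), exp (a * s) * W s := by
  have h := integral_comp_neg_Ioi 0 fun s : ℝ => exp (-(a * s)) * W s
  simpa [hWe.eq] using h.symm

lemma twoSidedExp_convolution_eq_add (ha : a.re ≤ 0) (hW : Integrable W) (ξ : ℝ) :
    (twoSidedExp a ⋆[ContinuousLinearMap.mul ℂ ℂ] W) ξ =
      exp (a * ξ) * (∫ s in Iic ξ, exp (-(a * s)) * W s) +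
        exp (-(a * ξ)) * ∫ s in Ioi ξ, exp (a * s) * W s := by
  have hleft : EqOn (fun s : ℝ => exp (a * ξ) * (exp (-(a * s)) * W s))
      (fun s : ℝ => twoSidedExp a (ξ - s) * W s) (Iic ξ) := fun s hs => by
    simp only [twoSidedExp_of_nonneg a (sub_nonneg.2 (mem_Iic.1 hs)), ← mul_assoc, ← exp_add]
    push_cast
    ring_nf
  have hright : EqOn (fun s : ℝ => exp (-(a * ξ)) * (exp (a * s) * W s))
      (fun s : ℝ => twoSidedExp a (ξ - s) * W s) (Ioi ξ) := fun s hs => by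
    simp only [twoSidedExp_of_nonpos a (sub_nonpos.2 (mem_Ioi.1 hs).le), ← mul_assoc, ← exp_add]
    push_cast
    ring_nf
  rw [convolution_mul_swap, ← integral_const_mul, ← integral_const_mul,
    setIntegral_congr_fun measurableSet_Iic hleft, setIntegral_congr_fun measurableSet_Ioi hright,
    intervalIntegral.integral_Iic_add_Ioi]
  · exact IntegrableOn.congr_fun ((integrableOn_Iic_exp_neg_mul ha hW ξ).const_mul _) hleft
      measurableSet_Iic
  · exact IntegrableOn.congr_fun ((integrableOn_Ioi_exp_mul ha hW ξ).const_mul _) hright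
      measurableSet_Ioi

lemma two_mul_integral_sinh_mul {ξ : ℝ} (hW : IntervalIntegrable W volume 0 ξ) :
    2 * ∫ s in (0 : ℝ)..ξ, sinh (a * (ξ - s)) * W s =
      exp (a * ξ) * (∫ s in (0 : ℝ)..ξ, exp (-(a * s)) * W s) -
        exp (-(a * ξ)) * ∫ s in (0 : ℝ)..ξ, exp (a * s) * W s := by
  simp only [← intervalIntegral.integral_const_mul]
  rw [← intervalIntegral.integral_sub]
  · congr 1 with s
    rw [sinh, show a * (ξ - s) = a * ξ + -(a * s) by ring, neg_add, neg_neg, exp_add, exp_add]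
    ring
  all_goals exact (hW.continuousOn_mul (by fun_prop)).const_mul _

lemma twoSidedExp_convolution_of_even (ha : a.re ≤ 0) (hW : Integrable W) (hWe : W.Even) (ξ : ℝ) :
    (twoSidedExp a ⋆[ContinuousLinearMap.mul ℂ ℂ] W) ξ =
      2 * (cosh (a * ξ) * (∫ s in Ioi (0 : ℝ), exp (a * s) * W s) +
        ∫ s in (0 : ℝ)..ξ, sinh (a * (ξ - s)) * W s) := by
  have hIic := intervalIntegral.integral_Iic_sub_Iic (integrableOn_Iic_exp_neg_mul ha hW 0)
    (integrableOn_Iic_exp_neg_mul ha hW ξ)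
  have hIoi := intervalIntegral.integral_interval_add_Ioi (integrableOn_Ioi_exp_mul ha hW 0)
    (integrableOn_Ioi_exp_mul ha hW ξ)
  rw [setIntegral_Iic_exp_neg_mul_of_even hWe] at hIic
  rw [twoSidedExp_convolution_eq_add ha hW, mul_add, two_mul_integral_sinh_mul
    hW.intervalIntegrable, cosh]
  linear_combination exp (a * ξ) * hIic + exp (-(a * ξ)) * hIoi

end Convolution

/-! ### Powers of the hyperbolic secant and the Beta integral -/

/-- The kernel `s ↦ sech(s/2)^c`. It is encoded as the inverse of a complex power of the positive
real `cosh (s/2)`, so that dividing by `cosh^c (s/2)` is multiplication by this function. -/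
noncomputable def sechCpow (c : ℂ) (s : ℝ) : ℂ := ((Real.cosh (s / 2) : ℂ) ^ c)⁻¹

lemma div_cosh_cpow (z c : ℂ) (s : ℝ) :
    z / (Real.cosh (s / 2) : ℂ) ^ c = z * sechCpow c s :=
  div_eq_mul_inv _ _

lemma even_sechCpow (c : ℂ) : (sechCpow c).Even := fun s => by
  rw [sechCpow, neg_div, Real.cosh_neg, sechCpow]

lemma sechCpow_add (u v : ℂ) (s : ℝ) : sechCpow (u + v) s = sechCpow u s * sechCpow v s := by
  have hne : (Real.cosh (s / 2) : ℂ) ≠ 0 := ofReal_ne_zero.2 (Real.cosh_pos _).ne'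
  rw [sechCpow, cpow_add _ _ hne, mul_inv, sechCpow, sechCpow]

lemma sigmoid_eq_exp_div_two_mul_cosh (s : ℝ) :
    Real.sigmoid s = Real.exp (s / 2) / (2 * Real.cosh (s / 2)) := by
  have hsq : Real.exp (-s) = Real.exp (-(s / 2)) / Real.exp (s / 2) := by
    rw [← Real.exp_sub]; ring_nf
  rw [Real.sigmoid_def, Real.cosh_eq, hsq]
  field_simp

lemma sigmoid_cpow (u : ℂ) (s : ℝ) :
    (Real.sigmoid s : ℂ) ^ u = 2 ^ (-u) * exp (u / 2 * s) * sechCpow u s := by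
  have hexp : (Real.exp (s / 2) : ℂ) ^ u = exp (u / 2 * s) := by
    rw [cpow_def_of_ne_zero (ofReal_ne_zero.2 (Real.exp_ne_zero _)),
      ← ofReal_log (Real.exp_pos _).le, Real.log_exp]
    push_cast
    ring_nf
  have hcosh := (Real.cosh_pos (s / 2)).le
  rw [sigmoid_eq_exp_div_two_mul_cosh, ofReal_div,
    div_cpow_ofReal_nonneg (Real.exp_pos _).le (by positivity), ofReal_mul,
    mul_cpow_ofReal_nonneg zero_le_two hcosh, hexp, cpow_neg, sechCpow, ofReal_ofNat]
  ring

lemma sigmoid_cpow_mul_one_sub_sigmoid_cpow (u v : ℂ) (s : ℝ) :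
    (Real.sigmoid s : ℂ) ^ u * (1 - (Real.sigmoid s : ℂ)) ^ v =
      2 ^ (-(u + v)) * (exp ((u - v) / 2 * s) * sechCpow (u + v) s) := by
  have hneg : 1 - (Real.sigmoid s : ℂ) = (Real.sigmoid (-s) : ℂ) := by
    rw [Real.sigmoid_neg]; push_cast; rfl
  have hexp : exp ((u - v) / 2 * s) = exp (u / 2 * s) * exp (v / 2 * ((-s : ℝ) : ℂ)) := by
    rw [← exp_add]; push_cast; ring_nf
  rw [hneg, sigmoid_cpow, sigmoid_cpow, even_sechCpow, hexp, neg_add, cpow_add _ _ two_ne_zero,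
    sechCpow_add]
  ring

section Sigmoid

variable {E : Type*} [NormedAddCommGroup E] [NormedSpace ℝ E] {f : ℝ → E}

lemma integrableOn_Ioo_iff_integrable_sigmoid_smul :
    IntegrableOn f (Ioo 0 1) ↔
      Integrable fun s => (Real.sigmoid s * (1 - Real.sigmoid s)) • f (Real.sigmoid s) := by
  rw [← Real.range_sigmoid, ← image_univ, ← integrableOn_univ]
  exact integrableOn_image_iff_integrableOn_deriv_smul_of_monotoneOn .univ
    (fun s _ => (Real.hasDerivAt_sigmoid s).hasDerivWithinAt) (Real.sigmoid_monotone.monotoneOn _) f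

lemma setIntegral_Ioo_eq_integral_sigmoid_smul (f : ℝ → E) :
    ∫ x in Ioo 0 1, f x =
      ∫ s, (Real.sigmoid s * (1 - Real.sigmoid s)) • f (Real.sigmoid s) := by
  have h := integral_image_eq_integral_deriv_smul_of_monotoneOn .univ
    (fun s _ => (Real.hasDerivAt_sigmoid s).hasDerivWithinAt) (Real.sigmoid_monotone.monotoneOn _) f
  rwa [image_univ, Real.range_sigmoid, setIntegral_univ] at h

end Sigmoid

lemma sigmoid_smul_beta_integrand (u v : ℂ) (s : ℝ) :
    (Real.sigmoid s * (1 - Real.sigmoid s)) •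
        ((Real.sigmoid s : ℂ) ^ (u - 1) * (1 - (Real.sigmoid s : ℂ)) ^ (v - 1)) =
      2 ^ (-(u + v)) * (exp ((u - v) / 2 * s) * sechCpow (u + v) s) := by
  have hσ : (Real.sigmoid s : ℂ) ≠ 0 := ofReal_ne_zero.2 (Real.sigmoid_pos s).ne'
  have hσ' : 1 - (Real.sigmoid s : ℂ) ≠ 0 := by
    exact_mod_cast (sub_pos.2 (Real.sigmoid_lt_one s)).ne'
  rw [← sigmoid_cpow_mul_one_sub_sigmoid_cpow, cpow_sub _ _ hσ, cpow_sub _ _ hσ', cpow_one,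
    cpow_one, real_smul]
  push_cast
  field_simp

lemma integrable_exp_mul_sechCpow {u v : ℂ} (hu : 0 < u.re) (hv : 0 < v.re) :
    Integrable (fun s : ℝ => exp ((u - v) / 2 * s) * sechCpow (u + v) s) := by
  have hbeta := betaIntegral_convergent hu hv
  rw [intervalIntegrable_iff_integrableOn_Ioo_of_le zero_le_one,
    integrableOn_Ioo_iff_integrable_sigmoid_smul] at hbeta
  simpa only [sigmoid_smul_beta_integrand, integrable_const_mul_iff
    (IsUnit.mk0 ((2 : ℂ) ^ (-(u + v))) (by simp [cpow_eq_zero_iff]))] using hbeta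

lemma betaIntegral_eq_integral_exp_mul_sechCpow (u v : ℂ) :
    betaIntegral u v =
      2 ^ (-(u + v)) * ∫ s : ℝ, exp ((u - v) / 2 * s) * sechCpow (u + v) s := by
  rw [betaIntegral, intervalIntegral.integral_of_le zero_le_one, integral_Ioc_eq_integral_Ioo,
    setIntegral_Ioo_eq_integral_sigmoid_smul]
  simp only [sigmoid_smul_beta_integrand, integral_const_mul]

lemma integrable_sechCpow {c : ℂ} (hc : 0 < c.re) : Integrable (sechCpow c) := by
  have hc' : 0 < (c / 2).re := by rw [div_ofNat_re]; positivity
  simpa using integrable_exp_mul_sechCpow hc' hc'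

lemma integrable_sechCpow_two_mul_add_two {a : ℂ} (ha : -1 < a.re) :
    Integrable (sechCpow (2 * a + 2)) := by
  refine integrable_sechCpow ?_
  rw [← mul_add_one, ← ofReal_ofNat, re_ofReal_mul, add_re, one_re]
  linarith

/-! ### The product of Gamma functions as a product of Fourier transforms -/

lemma Gamma_mul_Gamma_eq_fourier_sechCpow {b : ℂ} (hb : 0 < b.re) (w : ℝ) :
    Gamma (b + I * (2 * π * w : ℝ)) * Gamma (b - I * (2 * π * w : ℝ)) =
      2 ^ (-(2 * b)) * Gamma (2 * b) * 𝓕 (sechCpow (2 * b)) w := by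
  set t : ℝ := 2 * π * w with ht
  have hadd : 0 < (b + I * t).re := by simpa
  have hsub : 0 < (b - I * t).re := by simpa
  rw [mul_comm, Gamma_mul_Gamma_eq_betaIntegral hsub hadd,
    betaIntegral_eq_integral_exp_mul_sechCpow, sub_add_add_cancel, ← two_mul,
    fourier_eq_integral_mul_exp, ← ht, show (b - I * t - (b + I * t)) / 2 = -I * t by ring]
  simp only [mul_comm (exp _)]
  ring

lemma ofReal_sqrt_pi_ne_zero : ((√π : ℝ) : ℂ) ≠ 0 :=
  ofReal_ne_zero.2 (Real.sqrt_pos.2 Real.pi_pos).ne'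

lemma two_cpow_neg_mul_Gamma_two_mul (b : ℂ) :
    2 ^ (-(2 * b)) * Gamma (2 * b) = Gamma b * Gamma (b + 1 / 2) / (2 * (√π : ℝ)) := by
  have hsqrt := ofReal_sqrt_pi_ne_zero
  rw [Gamma_mul_Gamma_add_half, sub_eq_add_neg, cpow_add _ _ two_ne_zero, cpow_one]
  field_simp

section GammaProduct

variable {a : ℂ} (ha : -1 < a.re) (ha' : a.re < 0)

include ha ha'

lemma Gamma_mul_Gamma_eq_fourier_mul_fourier (w : ℝ) :
    Gamma (a + I * (2 * π * w : ℝ)) * Gamma (a - I * (2 * π * w : ℝ)) =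
      -(Gamma (a + 1) * Gamma (a + 3 / 2) / (4 * (√π : ℝ) * a)) *
        (𝓕 (twoSidedExp a) w * 𝓕 (sechCpow (2 * a + 2)) w) := by
  have hb : 0 < (a + 1).re := by simpa [← neg_lt_iff_pos_add] using ha
  have ha0 : a ≠ 0 := by rintro rfl; simp at ha'
  have hpair := Gamma_mul_Gamma_eq_fourier_sechCpow hb w
  rw [two_cpow_neg_mul_Gamma_two_mul, show a + 1 + 1 / 2 = a + 3 / 2 by ring,
    show 2 * (a + 1) = 2 * a + 2 by ring, add_right_comm, add_sub_right_comm,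
    Gamma_add_one _ (add_I_mul_ne_zero ha'.ne _), Gamma_add_one _ (sub_I_mul_ne_zero ha'.ne _)]
    at hpair
  have hadd := add_I_mul_ne_zero ha'.ne (2 * π * w)
  have hsub := sub_I_mul_ne_zero ha'.ne (2 * π * w)
  have hsqrt := ofReal_sqrt_pi_ne_zero
  rw [fourier_twoSidedExp ha', ← add_I_mul_mul_sub_I_mul]
  generalize ((2 * π * w : ℝ) : ℂ) = t at *
  field_simp at hpair ⊢
  linear_combination 2 * hpair

lemma integrable_Gamma_mul_Gamma :
    Integrable (fun t : ℝ => Gamma (a + I * t) * Gamma (a - I * t)) := by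
  rw [← integrable_comp_mul_left_iff _ Real.two_pi_pos.ne',
    funext (Gamma_mul_Gamma_eq_fourier_mul_fourier ha ha')]
  exact (integrable_fourier_mul_fourier (integrable_fourier_twoSidedExp ha')
    (integrable_sechCpow_two_mul_add_two ha)).const_mul _

lemma integral_Gamma_mul_Gamma_mul_exp (ξ : ℝ) :
    ∫ t : ℝ, Gamma (a + I * t) * Gamma (a - I * t) * exp (-I * ξ * t) =
      -(√π : ℝ) * Gamma (a + 1) * Gamma (a + 3 / 2) / (2 * a) *
        (twoSidedExp a ⋆[ContinuousLinearMap.mul ℂ ℂ] sechCpow (2 * a + 2)) ξ := by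
  have hfourier := congrFun (fourier_fourier_mul_fourier_of_even (continuous_twoSidedExp a)
    (integrable_twoSidedExp ha') (integrable_fourier_twoSidedExp ha')
    (integrable_sechCpow_two_mul_add_two ha) (even_twoSidedExp a) (even_sechCpow _)) ξ
  have hconst (c : ℂ) (f : ℝ → ℂ) : 𝓕 (fun w => c * f w) ξ = c * 𝓕 f ξ := by
    simp only [fourier_eq_integral_mul_exp, mul_assoc, integral_const_mul]
  rw [integral_mul_exp_neg_I_mul (fun t : ℝ => Gamma (a + I * t) * Gamma (a - I * t)),
    funext (Gamma_mul_Gamma_eq_fourier_mul_fourier ha ha'), hconst, hfourier]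
  have hsqrt := ofReal_sqrt_pi_ne_zero
  have hsq : ((√π : ℝ) : ℂ) ^ 2 = π := by exact_mod_cast Real.sq_sqrt Real.pi_pos.le
  rw [← hsq]
  field_simp
  ring

end GammaProduct

end

theorem theorem2 (a : ℂ) (ha : -1 < a.re) (ha' : a.re < 0) (ξ : ℝ) :
    Integrable (fun t : ℝ =>
      Complex.Gamma (a + Complex.I * t) * Complex.Gamma (a - Complex.I * t) *
        Complex.exp (-Complex.I * ξ * t)) ∧
    IntegrableOn (fun s : ℝ =>
      Complex.exp (a * s) / ((Real.cosh (s / 2) : ℝ) : ℂ) ^ (2 * a + 2)) (Set.Ioi 0) ∧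
    IntervalIntegrable (fun s : ℝ =>
      Complex.sinh (a * (ξ - s)) / ((Real.cosh (s / 2) : ℝ) : ℂ) ^ (2 * a + 2)) volume 0 ξ ∧
    ∫ t : ℝ, Complex.Gamma (a + Complex.I * t) * Complex.Gamma (a - Complex.I * t) *
        Complex.exp (-Complex.I * ξ * t) =
      -((√Real.pi : ℝ) : ℂ) * Complex.Gamma (a + 1) * Complex.Gamma (a + 3 / 2) / a *
        (Complex.cosh (a * ξ) *
            (∫ s in Set.Ioi (0 : ℝ),
              Complex.exp (a * s) / ((Real.cosh (s / 2) : ℝ) : ℂ) ^ (2 * a + 2)) +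
          ∫ s in (0 : ℝ)..ξ,
            Complex.sinh (a * (ξ - s)) / ((Real.cosh (s / 2) : ℝ) : ℂ) ^ (2 * a + 2)) := by
  have hW := integrable_sechCpow_two_mul_add_two ha
  simp only [div_cosh_cpow]
  refine ⟨integrable_mul_exp_neg_I_mul (integrable_Gamma_mul_Gamma ha ha') ξ,
    integrableOn_Ioi_exp_mul ha'.le hW 0,
    hW.intervalIntegrable.continuousOn_mul (Continuous.continuousOn (by fun_prop)), ?_⟩
  rw [integral_Gamma_mul_Gamma_mul_exp ha ha',
    twoSidedExp_convolution_of_even ha'.le hW (even_sechCpow _)]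
  ring
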